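/- All logarithms are in base $2$. For $x\in\mathbb{R}$ and an integer $s\ge 0$ let $\binom{x}{s}=x(x-1)\cdots(x-s+1)/s!$ if $x\ge s$ and $\binom{x}{s}=0$ if $x<s$. For an abelian group $G$ and a real number $x\ge 1$ let $\beta_G(x)=\max\{|H| : H\le G,\ |H|\le x\}$ be the size of the largest subgroup of $G$ of size at most $x$. **Theorem 1.2.** Let $m=m(n)$ and $s=s(n)$, $n\ge 1$, be sequences of positive integers such that $2s\le m$ for every $n\ge 1$ and $m=o\big(s^2/(\log n)^2\big)$ as $n\to\infty$. Then there are real sequences $e_1(n)=o(s)$ and $0\le e_2(n)=o(m)$ as $n\to\infty$, depending only on the sequences $m$ and $s$, such that for every $n\ge 1$, every abelian group $G$ and every $n$-element subset $Y\subseteq G$, the number of $s$-element subsets $A\subseteq Y$ with $|A+A|\le m$ is at most $$2^{e_1(n)}\binom{\frac{m+\beta}{2}}{s},\qquad\text{where } \beta=\beta_G\big(m+e_2(n)\big).$$ -/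

import Mathlib

open Filter Asymptotics
open scoped Pointwise

/-- `smallSumsetFamily Y m s` is the family of all `s`-element subsets `A` of the finite set `Y`
whose sumset satisfies `|A + A| ≤ m`. -/
def smallSumsetFamily {G : Type*} [AddCommGroup G] [DecidableEq G]
    (Y : Finset G) (m s : ℕ) : Finset (Finset G) :=
  {A ∈ Y.powersetCard s | (A + A).card ≤ m}

/-- `subgroupBeta G x` is the size of the largest finite subgroup of `G` of size at most `x`.
For `1 ≤ x` the set below is nonempty, and it is always bounded by `x`, so that the supremum
is a maximum. -/
noncomputable def subgroupBeta (G : Type*) [AddCommGroup G] (x : ℝ) : ℕ :=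
  sSup {k : ℕ | ∃ H : AddSubgroup G, Finite H ∧ Nat.card H = k ∧ (k : ℝ) ≤ x}

/-- The binomial coefficient with a real upper entry: `x (x - 1) ⋯ (x - s + 1) / s!` if `s ≤ x`,
and `0` if `x < s`. -/
noncomputable def realBinom (x : ℝ) (s : ℕ) : ℝ :=
  if (s : ℝ) ≤ x then (∏ i ∈ Finset.range s, (x - i)) / (s.factorial : ℝ) else 0

/-! The proof is a container argument resting on a Pollard-type inequality. Suppose |D| ≤ m and all
but γ²m² pairs in C × C have their sum in D. Large finite subgroups are the only obstruction to C +
C having many popular sums, so `mul_min_le_truncatedRepSum` gives |C| ≤ (m + β)/2 + O(γm)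
(`card_le_of_outPairs_le`).

Each A in the family is trapped in such a C by revealing few of its elements. First, O(√m) elements
of A confine it to at most 2m elements of Y. Then, with A ⊆ C and D ⊆ A + A, as long as εm² pairs of
C have sums outside D, revealing O(√m/ε) more elements shrinks C or enlarges D so that |C| - |D|
drops by εm/8 (`exists_container_step`). Since |D| ≤ |A + A| ≤ m, this ends after O(1/ε) rounds.

For fixed ε the number of containers is thus 2^{O(√m log n)}, which is 2^{o(s)} exactly because m =
o(s²/(log n)²). Each final container holds at most binom(|C|, s) sets, and `realBinom_add_le`
absorbs the excess O(γm) in the upper entry into a factor 2^{o(s)}. Letting ε tend to 0 slowly with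
n gives the error terms. -/

/-! ### Pollard-type inequality via the Dyson transform -/

section Pollard

variable {G : Type*} [AddCommGroup G] [DecidableEq G]

/-- The number of representations `x = u + v` with `u ∈ U` and `v ∈ V`. -/
def repCount (U V : Finset G) (x : G) : ℕ := {u ∈ U | x - u ∈ V}.card

/-- The sum over all `x` of the number of representations of `x` in `U + V`, truncated at `t`. -/
def truncatedRepSum (t : ℕ) (U V : Finset G) : ℕ := ∑ x ∈ U + V, min t (repCount U V x)

lemma repCount_comm (U V : Finset G) (x : G) : repCount U V x = repCount V U x := by
  unfold repCount
  refine Finset.card_bij' (fun u _ => x - u) (fun u _ => x - u) ?_ ?_ ?_ ?_ <;>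
    simp +contextual

lemma repCount_union_left {U₁ U₂ : Finset G} (h : Disjoint U₁ U₂) (V : Finset G) (x : G) :
    repCount (U₁ ∪ U₂) V x = repCount U₁ V x + repCount U₂ V x := by
  unfold repCount
  rw [Finset.filter_union, Finset.card_union_of_disjoint]
  exact Finset.disjoint_filter_filter h

lemma repCount_union_right {V₁ V₂ : Finset G} (h : Disjoint V₁ V₂) (U : Finset G) (x : G) :
    repCount U (V₁ ∪ V₂) x = repCount U V₁ x + repCount U V₂ x := by
  rw [repCount_comm, repCount_union_left h, repCount_comm V₁, repCount_comm V₂]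

lemma repCount_le_card_right (U V : Finset G) (x : G) : repCount U V x ≤ V.card := by
  rw [repCount_comm]
  exact Finset.card_filter_le _ _

lemma repCount_eq_zero {U V : Finset G} {x : G} (h : x ∉ U + V) : repCount U V x = 0 := by
  unfold repCount
  rw [Finset.card_eq_zero, Finset.filter_eq_empty_iff]
  intro u hu hv
  exact h (Finset.mem_add.2 ⟨u, hu, x - u, hv, by abel⟩)

lemma truncatedRepSum_eq_sum {t : ℕ} {U V S : Finset G} (h : U + V ⊆ S) :
    truncatedRepSum t U V = ∑ x ∈ S, min t (repCount U V x) := by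
  refine Finset.sum_subset h fun x _ hx => ?_
  simp [repCount_eq_zero hx]

lemma sum_repCount {U V S : Finset G} (h : U + V ⊆ S) :
    ∑ x ∈ S, repCount U V x = U.card * V.card := by
  rw [← Finset.card_product, Finset.card_eq_sum_card_fiberwise (f := fun p : G × G => p.1 + p.2)
    (t := S)]
  · refine Finset.sum_congr rfl fun x _ => ?_
    unfold repCount
    refine Finset.card_bij' (fun u _ => (u, x - u)) (fun p _ => p.1) ?_ ?_ ?_ ?_
    · simp +contextual
    · rintro ⟨a, b⟩
      simp only [Finset.mem_filter, Finset.mem_product]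
      rintro ⟨⟨ha, hb⟩, rfl⟩
      simp [ha, hb]
    · simp
    · rintro ⟨a, b⟩
      simp only [Finset.mem_filter, Finset.mem_product]
      rintro ⟨⟨ha, hb⟩, rfl⟩
      simp
  · rintro ⟨a, b⟩ hp
    simp only [Finset.coe_product, Set.mem_prod, Finset.mem_coe] at hp
    exact h (Finset.add_mem_add hp.1 hp.2)

lemma truncatedRepSum_of_card_le {t : ℕ} {U V : Finset G} (h : V.card ≤ t) :
    truncatedRepSum t U V = U.card * V.card := by
  rw [← sum_repCount (subset_refl (U + V)), truncatedRepSum]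
  exact Finset.sum_congr rfl fun x _ => min_eq_right ((repCount_le_card_right U V x).trans h)

lemma truncatedRepSum_vadd_right (t : ℕ) (U V : Finset G) (e : G) :
    truncatedRepSum t U (e +ᵥ V) = truncatedRepSum t U V := by
  unfold truncatedRepSum
  refine Finset.sum_bij' (fun x _ => x - e) (fun x _ => x + e) ?_ ?_ ?_ ?_ ?_
  · intro x hx
    obtain ⟨u, hu, w, hw, rfl⟩ := Finset.mem_add.1 hx
    obtain ⟨v, hv, rfl⟩ := Finset.mem_vadd_finset.1 hw
    exact Finset.mem_add.2 ⟨u, hu, v, hv, by simp only [vadd_eq_add]; abel⟩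
  · intro x hx
    obtain ⟨u, hu, v, hv, rfl⟩ := Finset.mem_add.1 hx
    exact Finset.mem_add.2 ⟨u, hu, e + v, Finset.mem_vadd_finset.2 ⟨v, hv, rfl⟩, by abel⟩
  · simp
  · simp
  · intro x _
    refine congrArg (min t) (congrArg Finset.card (Finset.filter_congr fun u _ => ?_))
    rw [Finset.mem_vadd_finset]
    constructor
    · rintro ⟨v, hv, h⟩
      rw [vadd_eq_add] at h
      have : x - e - u = v := by rw [sub_right_comm, ← h]; abel
      exact this ▸ hv
    · intro h
      exact ⟨_, h, by simp only [vadd_eq_add]; abel⟩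

/-- With I = U ∩ V, P = U \ V, Q = V \ U, this is the convolution identity (I + P)(I + Q) = (I + P +
Q)I + PQ. Keeping the PQ term is what allows the truncation level to be split between the two pairs.
-/
lemma repCount_eq_union_inter_add_sdiff (U V : Finset G) (x : G) :
    repCount U V x = repCount (U ∪ V) (U ∩ V) x + repCount (U \ V) (V \ U) x := by
  have h1 : repCount U V x = repCount (U ∩ V) V x + repCount (U \ V) V x := by
    rw [← repCount_union_left]
    · rw [Finset.union_comm, Finset.sdiff_union_inter]
    · exact (Finset.disjoint_sdiff_inter U V).symm
  have h2 : repCount (U \ V) V x = repCount (U \ V) (U ∩ V) x + repCount (U \ V) (V \ U) x := by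
    rw [← repCount_union_right]
    · rw [Finset.inter_comm, Finset.union_comm, Finset.sdiff_union_inter]
    · rw [Finset.inter_comm]
      exact (Finset.disjoint_sdiff_inter V U).symm
  have h3 : repCount (U ∪ V) (U ∩ V) x = repCount V (U ∩ V) x + repCount (U \ V) (U ∩ V) x := by
    rw [← repCount_union_left Finset.disjoint_sdiff]
    rw [Finset.union_sdiff_self_eq_union, Finset.union_comm]
  rw [repCount_comm V] at h3
  omega

lemma union_add_inter_subset (U V : Finset G) : (U ∪ V) + (U ∩ V) ⊆ U + V := by
  rw [Finset.union_add]
  refine Finset.union_subset (Finset.add_subset_add_left Finset.inter_subset_right) ?_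
  rw [add_comm U V]
  exact Finset.add_subset_add_left Finset.inter_subset_left

lemma truncatedRepSum_union_inter_le (t : ℕ) (U V : Finset G) :
    truncatedRepSum t (U ∪ V) (U ∩ V) ≤ truncatedRepSum t U V := by
  rw [truncatedRepSum_eq_sum (union_add_inter_subset U V), truncatedRepSum]
  refine Finset.sum_le_sum fun x _ => min_le_min_left _ ?_
  rw [repCount_eq_union_inter_add_sdiff U V]
  exact Nat.le_add_right _ _

lemma truncatedRepSum_union_inter_add_sdiff_le (i j : ℕ) (U V : Finset G) :
    truncatedRepSum i (U ∪ V) (U ∩ V) + truncatedRepSum j (U \ V) (V \ U) ≤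
      truncatedRepSum (i + j) U V := by
  rw [truncatedRepSum_eq_sum (union_add_inter_subset U V), truncatedRepSum_eq_sum
    (Finset.add_subset_add Finset.sdiff_subset Finset.sdiff_subset : (U \ V) + (V \ U) ⊆ U + V),
    truncatedRepSum, ← Finset.sum_add_distrib]
  refine Finset.sum_le_sum fun x _ => ?_
  rw [repCount_eq_union_inter_add_sdiff U V]
  omega

/-- If every translate of `V` which meets `U` is contained in `U`, then `U` is a union of cosets of
the subgroup generated by `V - V`. -/
lemma exists_subgroup_of_translates {U V : Finset G} (hU : U.Nonempty) (hV : V.Nonempty)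
    (h : ∀ e : G, (U ∩ (e +ᵥ V)).Nonempty → e +ᵥ V ⊆ U) :
    (∃ H : AddSubgroup G, Finite H ∧ V.card ≤ Nat.card H ∧ Nat.card H ≤ U.card) ∧
      ∀ x ∈ U + V, repCount U V x = V.card := by
  have key : ∀ u ∈ U, ∀ v ∈ V, ∀ w ∈ V, u - v + w ∈ U := by
    intro u hu v hv w hw
    refine h (u - v) ⟨u, Finset.mem_inter.2 ⟨hu, ?_⟩⟩ ?_
    · exact Finset.mem_vadd_finset.2 ⟨v, hv, by simp⟩
    · exact Finset.mem_vadd_finset.2 ⟨w, hw, by simp⟩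
  constructor
  · obtain ⟨u₀, hu₀⟩ := hU
    obtain ⟨v₀, hv₀⟩ := hV
    set H : AddSubgroup G := AddSubgroup.closure ((V : Set G) - V) with hH
    have hstab : ∀ g ∈ H, ∀ u ∈ U, u + g ∈ U := by
      intro g hg
      induction hg using AddSubgroup.closure_induction'' with
      | mem x hx =>
        obtain ⟨a, ha, b, hb, rfl⟩ := Set.mem_sub.1 hx
        intro u hu
        have := key u hu b hb a ha
        rwa [sub_add_eq_add_sub, add_sub_assoc] at this
      | neg_mem x hx =>
        obtain ⟨a, ha, b, hb, rfl⟩ := Set.mem_sub.1 hx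
        intro u hu
        have := key u hu a ha b hb
        rwa [sub_add_eq_add_sub, add_sub_assoc, ← neg_sub a b] at this
      | zero => simp
      | add x y _ _ hx hy =>
        intro u hu
        rw [← add_assoc]
        exact hy _ (hx u hu)
    let f : H → U := fun g => ⟨u₀ + g, hstab g g.2 u₀ hu₀⟩
    have hf : Function.Injective f := fun a b hab => by
      simpa [f] using hab
    have hfin : Finite H := Finite.of_injective f hf
    refine ⟨H, hfin, ?_, ?_⟩
    · let g : V → H := fun v => ⟨v - v₀, AddSubgroup.subset_closure
        (Set.sub_mem_sub v.2 hv₀)⟩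
      have hg : Function.Injective g := fun a b hab => by
        exact Subtype.ext (sub_left_injective (congrArg Subtype.val hab))
      simpa using Nat.card_le_card_of_injective g hg
    · simpa using Nat.card_le_card_of_injective f hf
  · intro x hx
    obtain ⟨u, hu, v, hv, rfl⟩ := Finset.mem_add.1 hx
    rw [repCount_comm, repCount, Finset.filter_true_of_mem]
    intro w hw
    have := key u hu w hw v hv
    rwa [sub_add_eq_add_sub] at this

/-- A Pollard-type theorem in abelian groups: if every finite subgroup of size at most `μ` has size
at most `b`, then truncated representation counts of `U + V` are large on average. -/
theorem mul_min_le_truncatedRepSum {b μ : ℝ} (hb0 : 0 ≤ b)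
    (hb : ∀ H : AddSubgroup G, Finite H → (Nat.card H : ℝ) ≤ μ → (Nat.card H : ℝ) ≤ b)
    {t : ℕ} {U V : Finset G} (htU : t ≤ U.card) (htV : t ≤ V.card) :
    (t : ℝ) * min μ (U.card + V.card - t - b) ≤ truncatedRepSum t U V := by
  induction hN : V.card using Nat.strong_induction_on generalizing t U V with
  | _ N ih =>
  subst hN
  rcases Nat.eq_zero_or_pos t with rfl | ht
  · simp
  have ht' : (0 : ℝ) < t := by exact_mod_cast ht
  -- Dyson transform: such a translate W of V makes U ∩ W nonempty and strictly smaller than V. If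
  -- none exists, U is a union of cosets.
  by_cases hex : ∃ e : G, (U ∩ (e +ᵥ V)).Nonempty ∧ ¬ e +ᵥ V ⊆ U
  · obtain ⟨e, hne, hsub⟩ := hex
    rw [← truncatedRepSum_vadd_right t U V e]
    have hcard : (e +ᵥ V).card = V.card := Finset.card_vadd_finset e V
    rw [← hcard] at htV ih ⊢
    generalize e +ᵥ V = W at *
    have hlt : (U ∩ W).card < W.card := by
      refine Finset.card_lt_card (Finset.inter_subset_right.ssubset_of_ne fun h => hsub ?_)
      exact Finset.inter_eq_right.1 h
    have hsum : ((U ∪ W).card : ℝ) + (U ∩ W).card = U.card + W.card := by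
      exact_mod_cast Finset.card_union_add_card_inter U W
    rcases le_or_gt t (U ∩ W).card with hi | hi
    · have h := ih _ hlt (U := U ∪ W) (V := U ∩ W)
        (hi.trans (Finset.card_le_card (Finset.inter_subset_left.trans Finset.subset_union_left)))
        hi rfl
      rw [hsum] at h
      exact h.trans (by exact_mod_cast truncatedRepSum_union_inter_le t U W)
    · have hUW : (U \ W).card + (U ∩ W).card = U.card := Finset.card_sdiff_add_card_inter U W
      have hWU : (W \ U).card + (U ∩ W).card = W.card := by
        rw [Finset.inter_comm]; exact Finset.card_sdiff_add_card_inter W U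
      have hpos : 0 < (U ∩ W).card := hne.card_pos
      -- The intersection is too small for level t. Level i = |U ∩ W| on (U ∪ W, U ∩ W) is exact,
      -- and induction handles the remaining j on the differences; in the non-μ case the two bounds
      -- add up with ib to spare.
      obtain ⟨j, rfl⟩ : ∃ j, t = (U ∩ W).card + j := ⟨t - (U ∩ W).card, by omega⟩
      have h := ih (W \ U).card (by omega) (t := j) (U := U \ W) (V := W \ U) (by omega)
        (by omega) rfl
      have h2 : (truncatedRepSum (U ∩ W).card (U ∪ W) (U ∩ W) : ℝ) +
          truncatedRepSum j (U \ W) (W \ U) ≤ truncatedRepSum ((U ∩ W).card + j) U W := by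
        exact_mod_cast truncatedRepSum_union_inter_add_sdiff_le _ j U W
      rw [truncatedRepSum_of_card_le le_rfl] at h2
      have hUW' : ((U \ W).card : ℝ) = U.card - (U ∩ W).card := by
        rw [← hUW]; push_cast; ring
      have hWU' : ((W \ U).card : ℝ) = W.card - (U ∩ W).card := by
        rw [← hWU]; push_cast; ring
      rw [hUW', hWU'] at h
      have hun : ((U ∪ W).card : ℝ) = U.card + W.card - (U ∩ W).card := by linarith
      push_cast at h2 ⊢
      rw [hun] at h2
      have hi0 : (0 : ℝ) ≤ ((U ∩ W).card : ℝ) := Nat.cast_nonneg _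
      have hj0 : (0 : ℝ) ≤ (j : ℝ) := Nat.cast_nonneg _
      generalize ((U ∩ W).card : ℝ) = i at *
      generalize (j : ℝ) = l at *
      set q := min μ ((U.card : ℝ) + W.card - (i + l) - b) with hq
      have hq1 : q ≤ μ := min_le_left _ _
      have hq2 : q ≤ (U.card : ℝ) + W.card - (i + l) - b := min_le_right _ _
      have hiq := mul_le_mul_of_nonneg_left hq2 hi0
      have hib := mul_nonneg hi0 hb0
      have hil := mul_nonneg hi0 hj0
      have hlq := mul_le_mul_of_nonneg_left hq2 hj0
      rcases min_choice μ ((U.card : ℝ) - i + (W.card - i) - l - b) with h3 | h3 <;> rw [h3] at h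
      · have := mul_le_mul_of_nonneg_left hq1 hj0
        linarith
      · linarith
  · push Not at hex
    have hU : U.Nonempty := Finset.card_pos.1 (ht.trans_le htU)
    have hV : V.Nonempty := Finset.card_pos.1 (ht.trans_le htV)
    obtain ⟨⟨H, hH, hVH, hHU⟩, hrep⟩ := exists_subgroup_of_translates hU hV hex
    have hge : t * U.card ≤ truncatedRepSum t U V := by
      rw [truncatedRepSum, Finset.sum_congr rfl fun x hx => by rw [hrep x hx, min_eq_left htV],
        Finset.sum_const, smul_eq_mul, mul_comm]
      exact Nat.mul_le_mul_right _ (Finset.card_le_card_add_right hV)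
    have hge' : (t : ℝ) * U.card ≤ truncatedRepSum t U V := by exact_mod_cast hge
    refine le_trans (mul_le_mul_of_nonneg_left ?_ ht'.le) hge'
    have h1 : (V.card : ℝ) ≤ Nat.card H := by exact_mod_cast hVH
    have h2 : (Nat.card H : ℝ) ≤ U.card := by exact_mod_cast hHU
    -- If |H| ≤ μ then |V| ≤ |H| ≤ b, so |U| + |V| - t - b ≤ |U|; otherwise μ < |H| ≤ |U|. Either
    -- way t|U| suffices.
    rcases le_or_gt (Nat.card H : ℝ) μ with h | h
    · refine (min_le_right _ _).trans ?_
      have := hb H hH h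
      linarith
    · exact (min_le_left _ _).trans (by linarith)

end Pollard

/-! ### Supersaturation and the ingredients of the container step -/

section Containers

variable {G : Type*} [AddCommGroup G] [DecidableEq G]

/-- The number of `y ∈ C` such that `v + y` is outside `D`. -/
def outDegree (C D : Finset G) (v : G) : ℕ := {y ∈ C | v + y ∉ D}.card

lemma outDegree_eq_card_sdiff (C D : Finset G) (v : G) :
    outDegree C D v = ((v +ᵥ C) \ D).card := by
  unfold outDegree
  refine Finset.card_bij' (fun y _ => v + y) (fun z _ => z - v) ?_ ?_ ?_ ?_
  · intro y hy
    rw [Finset.mem_filter] at hy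
    exact Finset.mem_sdiff.2 ⟨Finset.mem_vadd_finset.2 ⟨y, hy.1, rfl⟩, hy.2⟩
  · intro z hz
    rw [Finset.mem_sdiff, Finset.mem_vadd_finset] at hz
    obtain ⟨⟨y, hy, rfl⟩, hz⟩ := hz
    rw [vadd_eq_add] at hz ⊢
    simp [hy, hz]
  · simp
  · simp

/-- The number of pairs in `C × C` whose sum is outside `D`. -/
def outPairs (C D : Finset G) : ℕ := ∑ v ∈ C, outDegree C D v

lemma sum_repCount_sdiff (C D : Finset G) :
    ∑ x ∈ (C + C) \ D, repCount C C x = outPairs C D := by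
  unfold repCount outPairs
  have h := Finset.sum_card_bipartiteAbove_eq_sum_card_bipartiteBelow
    (s := (C + C) \ D) (t := C) (fun x u => x - u ∈ C)
  unfold Finset.bipartiteAbove Finset.bipartiteBelow at h
  rw [h]
  refine Finset.sum_congr rfl fun u hu => ?_
  unfold outDegree
  refine Finset.card_bij' (fun x _ => x - u) (fun y _ => u + y) ?_ ?_ ?_ ?_
  · intro x hx
    simp only [Finset.mem_filter, Finset.mem_sdiff] at hx
    simp [hx.1.2, hx.2]
  · intro y hy
    rw [Finset.mem_filter] at hy
    rw [Finset.mem_filter, Finset.mem_sdiff]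
    exact ⟨⟨Finset.add_mem_add hu hy.1, hy.2⟩, by simpa using hy.1⟩
  · simp
  · simp

lemma truncatedRepSum_le (t : ℕ) (C D : Finset G) :
    truncatedRepSum t C C ≤ t * D.card + outPairs C D := by
  rw [truncatedRepSum, ← Finset.sum_inter_add_sum_sdiff (C + C) D, ← sum_repCount_sdiff]
  refine add_le_add ?_ (Finset.sum_le_sum fun x _ => min_le_right _ _)
  calc _ ≤ ∑ _x ∈ (C + C) ∩ D, t := Finset.sum_le_sum fun x _ => min_le_left _ _
    _ = ((C + C) ∩ D).card * t := by rw [Finset.sum_const, smul_eq_mul]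
    _ ≤ D.card * t := Nat.mul_le_mul_right _ (Finset.card_le_card Finset.inter_subset_right)
    _ = t * D.card := mul_comm _ _

/-- Pollard's inequality is applied to (C, C) with t = ⌈γm⌉ and μ = m + 2γm. The truncated sum is at
most tm + γ²m² ≤ t(m + γm), which rules out the μ term of the minimum, and t < γm + 1 ≤ 2γm. -/
lemma card_le_of_outPairs_le {b m γ : ℝ} (hγ : 0 < γ) (hγ' : γ ≤ 1 / 4) (hm : 1 ≤ γ * m)
    (hb0 : 0 ≤ b)
    (hb : ∀ H : AddSubgroup G, Finite H → (Nat.card H : ℝ) ≤ m + 2 * γ * m →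
      (Nat.card H : ℝ) ≤ b)
    {C D : Finset G} (hD : (D.card : ℝ) ≤ m) (h : (outPairs C D : ℝ) ≤ γ ^ 2 * m ^ 2) :
    (C.card : ℝ) ≤ (m + b) / 2 + 3 / 2 * (γ * m) := by
  have hm0 : 0 < m := by
    by_contra! hm0
    nlinarith
  have ht1 : γ * m ≤ (⌈γ * m⌉₊ : ℝ) := Nat.le_ceil _
  have ht2 : (⌈γ * m⌉₊ : ℝ) < γ * m + 1 := Nat.ceil_lt_add_one (by linarith)
  rcases lt_or_ge C.card ⌈γ * m⌉₊ with hC | hC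
  · have hC' : (C.card : ℝ) ≤ (⌈γ * m⌉₊ : ℝ) := by exact_mod_cast hC.le
    have : γ * m ≤ 1 / 4 * m := mul_le_mul_of_nonneg_right hγ' hm0.le
    linarith
  · have h1 := mul_min_le_truncatedRepSum hb0 hb hC hC
    have h2 : (truncatedRepSum ⌈γ * m⌉₊ C C : ℝ) ≤ ⌈γ * m⌉₊ * D.card + outPairs C D := by
      exact_mod_cast truncatedRepSum_le _ C D
    generalize (⌈γ * m⌉₊ : ℝ) = t at *
    have ht0 : 0 < t := by linarith
    have h3 : t * (D.card : ℝ) ≤ t * m := mul_le_mul_of_nonneg_left hD ht0.le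
    have h4 : (γ * m) * (γ * m) ≤ t * (γ * m) :=
      mul_le_mul_of_nonneg_right ht1 (by linarith)
    have h5 : t * min (m + 2 * γ * m) (C.card + C.card - t - b) ≤ t * (m + γ * m) := by
      nlinarith
    have h6 := le_of_mul_le_mul_left h5 ht0
    rcases min_le_iff.1 h6 with h7 | h7 <;> linarith

/-- A maximal subset `F` of `A` with many sums. -/
lemma exists_subset_sums_saturated (A : Finset G) :
    ∃ F ⊆ A, F.card * F.card ≤ 4 * (F + F).card + F.card ∧
      ∀ a ∈ A, 2 * outDegree F (F + F) a < F.card := by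
  obtain ⟨F, hF, hmax⟩ := Finset.exists_max_image
    {F ∈ A.powerset | F.card * F.card ≤ 4 * (F + F).card + F.card} Finset.card
    ⟨∅, by simp⟩
  rw [Finset.mem_filter, Finset.mem_powerset] at hF
  refine ⟨F, hF.1, hF.2, fun a ha => ?_⟩
  by_contra! hcon
  by_cases haF : a ∈ F
  · have : outDegree F (F + F) a = 0 := by
      rw [outDegree, Finset.card_eq_zero, Finset.filter_eq_empty_iff]
      intro y hy
      simpa using Finset.add_mem_add haF hy
    have h0 := Finset.card_pos.2 ⟨a, haF⟩
    omega
  · have hsub : (F + F) ∪ ((a +ᵥ F) \ (F + F)) ⊆ insert a F + insert a F := by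
      refine Finset.union_subset ?_ (Finset.sdiff_subset.trans ?_)
      · exact Finset.add_subset_add (Finset.subset_insert _ _) (Finset.subset_insert _ _)
      · intro x hx
        obtain ⟨f, hf, rfl⟩ := Finset.mem_vadd_finset.1 hx
        exact Finset.add_mem_add (Finset.mem_insert_self _ _) (Finset.mem_insert_of_mem hf)
    have hc := Finset.card_le_card hsub
    rw [Finset.card_union_of_disjoint Finset.disjoint_sdiff, ← outDegree_eq_card_sdiff] at hc
    have hcard := Finset.card_insert_of_notMem haF
    have := hmax (insert a F) (by
      rw [Finset.mem_filter, Finset.mem_powerset, hcard]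
      refine ⟨Finset.insert_subset ha hF.1, ?_⟩
      -- Adding an element raises |F|² - |F| by 2|F|, and at least |F|/2 new sums raise 4|F + F| by
      -- as much.
      nlinarith [hF.2])
    omega

/-- Each counted y sends at least half of F into F + F, while each point of F + F is reached at most
|F| times. This makes the first container independent of |Y|. -/
lemma card_filter_outDegree_le {m : ℕ} (Y : Finset G) {F : Finset G} (hF : F.Nonempty)
    (hm : (F + F).card ≤ m) :
    {y ∈ Y | 2 * outDegree F (F + F) y < F.card}.card ≤ 2 * m := by
  set C := {y ∈ Y | 2 * outDegree F (F + F) y < F.card} with hC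
  have h := Finset.sum_card_bipartiteAbove_eq_sum_card_bipartiteBelow
    (s := F + F) (t := C) (fun x u => x - u ∈ F)
  unfold Finset.bipartiteAbove Finset.bipartiteBelow at h
  have h1 : ∑ x ∈ F + F, {u ∈ C | x - u ∈ F}.card ≤ (F + F).card * F.card := by
    rw [← smul_eq_mul, ← Finset.sum_const]
    exact Finset.sum_le_sum fun x _ => repCount_le_card_right C F x
  have h2 : ∀ y ∈ C, F.card ≤ 2 * {x ∈ F + F | x - y ∈ F}.card := by
    intro y hy
    have hy' := (Finset.mem_filter.1 hy).2
    have h3 : {f ∈ F | y + f ∈ F + F}.card + outDegree F (F + F) y = F.card :=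
      Finset.card_filter_add_card_filter_not _
    have h4 : {f ∈ F | y + f ∈ F + F}.card ≤ {x ∈ F + F | x - y ∈ F}.card := by
      refine Finset.card_le_card_of_injOn (fun f => y + f) ?_ (fun a _ b _ hab => by simpa using hab)
      intro f hf
      simp only [Finset.coe_filter, Set.mem_ofPred_eq] at hf ⊢
      simp [hf.1, hf.2]
    omega
  have h5 : C.card * F.card ≤ 2 * ((F + F).card * F.card) := by
    calc C.card * F.card = ∑ _y ∈ C, F.card := by rw [Finset.sum_const, smul_eq_mul]
      _ ≤ ∑ y ∈ C, 2 * {x ∈ F + F | x - y ∈ F}.card := Finset.sum_le_sum h2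
      _ = 2 * ∑ y ∈ C, {x ∈ F + F | x - y ∈ F}.card := by rw [Finset.mul_sum]
      _ ≤ _ := by rw [← h]; exact Nat.mul_le_mul_left _ h1
  rw [← mul_assoc] at h5
  have := Nat.le_of_mul_le_mul_right h5 hF.card_pos
  omega

/-- Greedily enlarging `D` by translates of `F` by elements of `A`. -/
lemma exists_translates_saturated (A F D : Finset G) {c : ℝ} (hc : 0 < c) :
    ∃ E ⊆ A, (D.card : ℝ) + c * E.card ≤ (D ∪ (E + F)).card ∧
      ∀ a ∈ A, (outDegree F (D ∪ (E + F)) a : ℝ) < c := by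
  classical
  obtain ⟨E, hE, hmax⟩ := Finset.exists_max_image
    {E ∈ A.powerset | (D.card : ℝ) + c * E.card ≤ (D ∪ (E + F)).card} Finset.card
    ⟨∅, by simp⟩
  rw [Finset.mem_filter, Finset.mem_powerset] at hE
  refine ⟨E, hE.1, hE.2, fun a ha => ?_⟩
  by_contra! hcon
  by_cases haE : a ∈ E
  · have : outDegree F (D ∪ (E + F)) a = 0 := by
      rw [outDegree, Finset.card_eq_zero, Finset.filter_eq_empty_iff]
      intro y hy
      exact not_not_intro (Finset.mem_union_right _ (Finset.add_mem_add haE hy))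
    rw [this] at hcon
    push_cast at hcon
    linarith
  · have hsub : (D ∪ (E + F)) ∪ ((a +ᵥ F) \ (D ∪ (E + F))) ⊆ D ∪ (insert a E + F) := by
      refine Finset.union_subset (Finset.union_subset_union_right
        (Finset.add_subset_add_right (Finset.subset_insert _ _))) (Finset.sdiff_subset.trans ?_)
      intro x hx
      obtain ⟨f, hf, rfl⟩ := Finset.mem_vadd_finset.1 hx
      exact Finset.mem_union_right _ (Finset.add_mem_add (Finset.mem_insert_self _ _) hf)
    have hc := Finset.card_le_card hsub
    rw [Finset.card_union_of_disjoint Finset.disjoint_sdiff, ← outDegree_eq_card_sdiff] at hc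
    have hc' : ((D ∪ (E + F)).card : ℝ) + outDegree F (D ∪ (E + F)) a ≤
      (D ∪ (insert a E + F)).card := by exact_mod_cast hc
    have hcard := Finset.card_insert_of_notMem haE
    have := hmax (insert a E) (by
      rw [Finset.mem_filter, Finset.mem_powerset, hcard]
      refine ⟨Finset.insert_subset ha hE.1, ?_⟩
      push_cast
      linarith [hE.2])
    omega

/-- The subsets of `Y` of size at most `K`. -/
def smallSubsets {α : Type*} (Y : Finset α) (K : ℕ) : Finset (Finset α) := {F ∈ Y.powerset | F.card ≤ K}

lemma card_smallSubsets_le {α : Type*} [DecidableEq α] (Y : Finset α) (K : ℕ) :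
    (smallSubsets Y K).card ≤ (Y.card + 1) ^ K := by
  have h : smallSubsets Y K ⊆ (Finset.range (K + 1)).biUnion fun i => Y.powersetCard i := by
    intro F hF
    rw [smallSubsets, Finset.mem_filter, Finset.mem_powerset] at hF
    rw [Finset.mem_biUnion]
    exact ⟨F.card, Finset.mem_range.2 (by omega), Finset.mem_powersetCard.2 ⟨hF.1, rfl⟩⟩
  refine (Finset.card_le_card h).trans (Finset.card_biUnion_le.trans ?_)
  rw [add_pow]
  refine Finset.sum_le_sum fun i hi => ?_
  rw [Finset.card_powersetCard, one_pow, mul_one]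
  refine (Nat.choose_le_pow _ _).trans (Nat.le_mul_of_pos_right _ ?_)
  exact Nat.choose_pos (by rw [Finset.mem_range] at hi; omega)

/-- Many out-pairs force many elements of large out-degree. -/
lemma card_highDegree_ge {C D : Finset G} {ε m : ℝ} (hm : 0 < m) (hε : 0 < ε)
    (hC : (C.card : ℝ) ≤ 2 * m) (h : ε * m ^ 2 ≤ outPairs C D) :
    ε * m / 4 ≤ ({v ∈ C | ε * m / 4 ≤ (outDegree C D v : ℝ)}.card : ℝ) := by
  have h1 : (outPairs C D : ℝ) ≤
      {v ∈ C | ε * m / 4 ≤ (outDegree C D v : ℝ)}.card * (2 * m) + 2 * m * (ε * m / 4) := by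
    rw [outPairs, Nat.cast_sum, ← Finset.sum_filter_add_sum_filter_not C
      (fun v => ε * m / 4 ≤ (outDegree C D v : ℝ))]
    refine add_le_add ?_ ?_
    · rw [← nsmul_eq_mul]
      refine Finset.sum_le_card_nsmul _ _ _ fun v _ => le_trans ?_ hC
      exact_mod_cast Finset.card_filter_le _ _
    · refine (Finset.sum_le_card_nsmul _ _ (ε * m / 4) fun v hv => ?_).trans ?_
      · exact (not_le.1 (Finset.mem_filter.1 hv).2).le
      · rw [nsmul_eq_mul]
        refine mul_le_mul_of_nonneg_right (le_trans ?_ hC) (by positivity)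
        exact_mod_cast Finset.card_filter_le _ _
  generalize ({v ∈ C | ε * m / 4 ≤ (outDegree C D v : ℝ)}.card : ℝ) = x at *
  have : ε * m / 4 * (2 * m) ≤ x * (2 * m) := by nlinarith
  exact le_of_mul_le_mul_right this (by linarith)

lemma card_drop_of_saturated {C D D' F : Finset G} {c d : ℝ} (hc : 0 ≤ c) (hDD : D ⊆ D')
    (hd : ∀ f ∈ F, d ≤ (outDegree C D f : ℝ)) :
    F.card * d ≤ F.card * ((C.card : ℝ) - {y ∈ C | (outDegree F D' y : ℝ) < c}.card +
      (D'.card - D.card)) + c * C.card := by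
  set C' := {y ∈ C | (outDegree F D' y : ℝ) < c} with hC'
  have hCC : C' ⊆ C := Finset.filter_subset _ _
  have h1 : ∀ f ∈ F, d ≤ ((C.card : ℝ) - C'.card + (D'.card - D.card)) + outDegree C' D' f := by
    intro f hf
    refine (hd f hf).trans ?_
    have hsub : {y ∈ C | f + y ∉ D} ⊆ (C \ C' ∪ {y ∈ C | f + y ∈ D' \ D}) ∪
        {y ∈ C' | f + y ∉ D'} := by
      intro y hy
      simp only [Finset.mem_union, Finset.mem_filter, Finset.mem_sdiff] at hy ⊢
      tauto
    have h2 : {y ∈ C | f + y ∈ D' \ D}.card ≤ (D' \ D).card := by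
      refine Finset.card_le_card_of_injOn (fun y => f + y) ?_ (fun a _ b _ hab => by simpa using hab)
      intro y hy
      exact (Finset.mem_filter.1 hy).2
    have h3 := (Finset.card_le_card hsub).trans ((Finset.card_union_le _ _).trans
      (Nat.add_le_add_right (Finset.card_union_le _ _) _))
    have h4 := Finset.card_sdiff_add_card_eq_card hCC
    have h5 := Finset.card_sdiff_add_card_eq_card hDD
    have h6 : outDegree C D f + C'.card + D.card ≤ C.card + D'.card + outDegree C' D' f := by
      unfold outDegree
      omega
    have h7 : (outDegree C D f : ℝ) + C'.card + D.card ≤ C.card + D'.card + outDegree C' D' f := by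
      exact_mod_cast h6
    linarith
  have h2 : ∑ f ∈ F, outDegree C' D' f = ∑ y ∈ C', outDegree F D' y := by
    have h := Finset.sum_card_bipartiteAbove_eq_sum_card_bipartiteBelow
      (s := F) (t := C') (fun f y => f + y ∉ D')
    unfold Finset.bipartiteAbove Finset.bipartiteBelow at h
    unfold outDegree
    rw [h]
    simp only [add_comm]
  have h3 : (∑ y ∈ C', (outDegree F D' y : ℝ)) ≤ c * C.card := by
    refine (Finset.sum_le_card_nsmul _ _ c fun y hy => (Finset.mem_filter.1 hy).2.le).trans ?_
    rw [nsmul_eq_mul, mul_comm]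
    exact mul_le_mul_of_nonneg_left (by exact_mod_cast Finset.card_le_card hCC) hc
  have h4 := Finset.sum_le_sum h1
  rw [Finset.sum_add_distrib, Finset.sum_const, Finset.sum_const, nsmul_eq_mul, nsmul_eq_mul,
    ← Nat.cast_sum, h2, Nat.cast_sum] at h4
  linarith

end Containers

/-! ### Iterating the container step and counting containers -/

section Counting

variable {G : Type*} [AddCommGroup G] [DecidableEq G]

/-- One step of the container algorithm. -/
lemma exists_container_step {Y C D : Finset G} {m k K : ℕ} {ε : ℝ} (hε : 0 < ε)
    (hm : 0 < m) (hk : 0 < k) (hmk : m ≤ k ^ 2) (hkm : 8 * (k : ℝ) ≤ ε * m) (hkK : k ≤ K)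
    (hK : 16 * (k : ℝ) ≤ ε * K) (hCY : C ⊆ Y) (hC : (C.card : ℝ) ≤ 2 * m)
    (h : ε * (m : ℝ) ^ 2 ≤ outPairs C D) :
    ∃ T : Finset (Finset G × Finset G), T.card ≤ 2 * (smallSubsets Y K).card ^ 2 ∧
      (∀ p ∈ T, p.1 ⊆ C ∧ (p.1.card : ℝ) - p.2.card ≤ C.card - D.card - ε * m / 8) ∧
      ∀ A ⊆ C, D ⊆ A + A → (A + A).card ≤ m → ∃ p ∈ T, A ⊆ p.1 ∧ p.2 ⊆ A + A := by
  classical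
  have hm' : (0 : ℝ) < m := by exact_mod_cast hm
  have hk' : (0 : ℝ) < k := by exact_mod_cast hk
  set P := smallSubsets Y K with hP
  set H := {v ∈ C | ε * m / 4 ≤ (outDegree C D v : ℝ)} with hH
  have hHcard : ε * m / 4 ≤ (H.card : ℝ) := card_highDegree_ge hm' hε hC h
  have hHC : H ⊆ C := Finset.filter_subset _ _
  -- Small enough that c|C| ≤ k·εm/8, half of the guaranteed drop, yet large enough that |E| ≤ m/c ≤
  -- 16k/ε ≤ K.
  set c : ℝ := ε * k / 16 with hc
  have hc0 : 0 < c := by positivity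
  let f₁ : Finset G → Finset G × Finset G := fun F => (C \ H ∪ F, D)
  let f₂ : Finset G × Finset G → Finset G × Finset G := fun q =>
    ({y ∈ C | (outDegree q.1 (D ∪ (q.2 + q.1)) y : ℝ) < c}, D ∪ (q.2 + q.1))
  refine ⟨(P.image f₁ ∪ (P ×ˢ P).image f₂).filter fun p =>
    p.1 ⊆ C ∧ (p.1.card : ℝ) - p.2.card ≤ C.card - D.card - ε * m / 8, ?_, ?_, ?_⟩
  · refine (Finset.card_filter_le _ _).trans ((Finset.card_union_le _ _).trans ?_)
    have h1 := Finset.card_image_le (s := P) (f := f₁)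
    have h2 := Finset.card_image_le (s := P ×ˢ P) (f := f₂)
    rw [Finset.card_product] at h2
    nlinarith [Nat.le_self_pow (two_ne_zero) P.card]
  · intro p hp
    exact (Finset.mem_filter.1 hp).2
  · intro A hAC hDA hAm
    have hmemP : ∀ F ⊆ A, F.card ≤ K → F ∈ P := fun F hF hFK => by
      rw [hP, smallSubsets, Finset.mem_filter, Finset.mem_powerset]
      exact ⟨hF.trans (hAC.trans hCY), hFK⟩
    -- If A has few high-degree elements, revealing all of them deletes the rest of H from C, at
    -- least εm/4 - k ≥ εm/8 elements. Otherwise k of them serve as F.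
    rcases lt_or_ge (A ∩ H).card k with hlt | hge
    · refine ⟨f₁ (A ∩ H), Finset.mem_filter.2 ⟨Finset.mem_union_left _ (Finset.mem_image_of_mem _
        (hmemP _ Finset.inter_subset_left (hlt.le.trans hkK))), ?_, ?_⟩, ?_, hDA⟩
      · exact Finset.union_subset Finset.sdiff_subset (Finset.inter_subset_right.trans hHC)
      · have h1 : ((C \ H ∪ A ∩ H).card : ℝ) ≤ (C \ H).card + (A ∩ H).card := by
          exact_mod_cast Finset.card_union_le _ _
        have h2 : ((C \ H).card : ℝ) + H.card = C.card := by
          exact_mod_cast Finset.card_sdiff_add_card_eq_card hHC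
        have h3 : ((A ∩ H).card : ℝ) ≤ k := by exact_mod_cast hlt.le
        simp only [f₁]
        linarith
      · intro a ha
        simp only [f₁, Finset.mem_union, Finset.mem_sdiff, Finset.mem_inter]
        by_cases haH : a ∈ H
        · exact Or.inr ⟨ha, haH⟩
        · exact Or.inl ⟨hAC ha, haH⟩
    · obtain ⟨F, hF, hFk⟩ := Finset.exists_subset_card_eq hge
      have hFA : F ⊆ A := hF.trans Finset.inter_subset_left
      obtain ⟨E, hEA, hE, hsat⟩ := exists_translates_saturated A F D hc0
      have hD' : D ∪ (E + F) ⊆ A + A :=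
        Finset.union_subset hDA (Finset.add_subset_add hEA hFA)
      have hEK : E.card ≤ K := by
        have h1 : ((D ∪ (E + F)).card : ℝ) ≤ m := by
          exact_mod_cast (Finset.card_le_card hD').trans hAm
        have h2 : c * E.card ≤ (k : ℝ) ^ 2 := by
          have : (m : ℝ) ≤ (k : ℝ) ^ 2 := by exact_mod_cast hmk
          have : (0 : ℝ) ≤ D.card := Nat.cast_nonneg _
          linarith
        have h3 : c * E.card ≤ c * K := by
          rw [hc] at h2 ⊢
          nlinarith
        exact_mod_cast le_of_mul_le_mul_left h3 hc0
      refine ⟨f₂ (F, E), Finset.mem_filter.2 ⟨Finset.mem_union_right _ (Finset.mem_image_of_mem _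
        (Finset.mem_product.2 ⟨hmemP F hFA (hFk.le.trans hkK), hmemP E hEA hEK⟩)), ?_, ?_⟩, ?_, hD'⟩
      · exact Finset.filter_subset _ _
      · have h1 := card_drop_of_saturated (C := C) (D := D) (D' := D ∪ (E + F)) (F := F)
          (d := ε * m / 4) hc0.le Finset.subset_union_left
          fun f hf => (Finset.mem_filter.1 (Finset.mem_inter.1 (hF hf)).2).2
        have h2 : c * C.card ≤ k * (ε * m / 8) := by
          have := mul_le_mul_of_nonneg_left hC hc0.le
          rw [hc] at this ⊢
          linarith
        rw [hFk] at h1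
        have h3 : (k : ℝ) * (ε * m / 4) ≤ k * ((C.card : ℝ) -
            {y ∈ C | (outDegree F (D ∪ (E + F)) y : ℝ) < c}.card +
              ((D ∪ (E + F)).card - D.card) + ε * m / 8) := by linarith
        have h4 := le_of_mul_le_mul_left h3 hk'
        simp only [f₂]
        linarith
      · intro a ha
        exact Finset.mem_filter.2 ⟨hAC ha, hsat a ha⟩

/-- The members `A` of `smallSumsetFamily Y m s` with `A ⊆ C` and `D ⊆ A + A`. -/
def containedFamily (Y : Finset G) (m s : ℕ) (C D : Finset G) : Finset (Finset G) :=
  {A ∈ smallSumsetFamily Y m s | A ⊆ C ∧ D ⊆ A + A}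

lemma mem_containedFamily {Y C D A : Finset G} {m s : ℕ} :
    A ∈ containedFamily Y m s C D ↔
      ((A ⊆ Y ∧ A.card = s) ∧ (A + A).card ≤ m) ∧ A ⊆ C ∧ D ⊆ A + A := by
  rw [containedFamily, smallSumsetFamily, Finset.mem_filter, Finset.mem_filter,
    Finset.mem_powersetCard]

/-- Induction on the number j of rounds left: the potential |C| + m - |D| loses εm/8 per round, and
once it is negative no A has D ⊆ A + A. -/
lemma card_containedFamily_le {Y : Finset G} {m s k K : ℕ} {ε M : ℝ} (hε : 0 < ε)
    (hm : 0 < m) (hk : 0 < k) (hmk : m ≤ k ^ 2) (hkm : 8 * (k : ℝ) ≤ ε * m) (hkK : k ≤ K)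
    (hK : 16 * (k : ℝ) ≤ ε * K) (hM0 : 0 ≤ M)
    (hM : ∀ C D : Finset G, D.card ≤ m → (outPairs C D : ℝ) ≤ ε * (m : ℝ) ^ 2 →
      (C.card.choose s : ℝ) ≤ M) (j : ℕ) {C D : Finset G} (hCY : C ⊆ Y)
    (hC : (C.card : ℝ) ≤ 2 * m) (hj : (C.card : ℝ) + m - D.card < j * (ε * m / 8)) :
    ((containedFamily Y m s C D).card : ℝ) ≤
      ((2 * (smallSubsets Y K).card ^ 2 : ℕ) : ℝ) ^ j * M := by
  induction j generalizing C D with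
  | zero =>
    have : containedFamily Y m s C D = ∅ := by
      rw [Finset.eq_empty_iff_forall_notMem]
      intro A hA
      rw [mem_containedFamily] at hA
      have h1 : (D.card : ℝ) ≤ m := by
        exact_mod_cast (Finset.card_le_card hA.2.2).trans hA.1.2
      have h2 : (0 : ℝ) ≤ C.card := Nat.cast_nonneg _
      simp only [Nat.cast_zero, zero_mul] at hj
      linarith
    simp [this, hM0]
  | succ j ih =>
    have hN : 1 ≤ 2 * (smallSubsets Y K).card ^ 2 := by
      have : 0 < (smallSubsets Y K).card := Finset.card_pos.2 ⟨∅, by simp [smallSubsets]⟩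
      have := pow_pos this 2
      omega
    rcases le_or_gt (outPairs C D : ℝ) (ε * (m : ℝ) ^ 2) with hout | hout
    · rcases (containedFamily Y m s C D).eq_empty_or_nonempty with h0 | ⟨A, hA⟩
      · rw [h0, Finset.card_empty, Nat.cast_zero]
        positivity
      · rw [mem_containedFamily] at hA
        have h1 := hM C D ((Finset.card_le_card hA.2.2).trans hA.1.2) hout
        have h2 : (containedFamily Y m s C D).card ≤ C.card.choose s := by
          rw [← Finset.card_powersetCard]
          refine Finset.card_le_card fun B hB => ?_
          rw [mem_containedFamily] at hB
          exact Finset.mem_powersetCard.2 ⟨hB.2.1, hB.1.1.2⟩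
        have h3 : ((containedFamily Y m s C D).card : ℝ) ≤ C.card.choose s := by exact_mod_cast h2
        refine h3.trans (h1.trans (le_mul_of_one_le_left hM0 (one_le_pow₀ ?_)))
        exact_mod_cast hN
    · obtain ⟨T, hT, hT1, hT2⟩ :=
        exists_container_step hε hm hk hmk hkm hkK hK hCY hC hout.le
      have hsub : containedFamily Y m s C D ⊆ T.biUnion fun p => containedFamily Y m s p.1 p.2 := by
        intro A hA
        rw [mem_containedFamily] at hA
        obtain ⟨p, hp, hp'⟩ := hT2 A hA.2.1 hA.2.2 hA.1.2
        exact Finset.mem_biUnion.2 ⟨p, hp, mem_containedFamily.2 ⟨hA.1, hp'⟩⟩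
      have h1 : ((containedFamily Y m s C D).card : ℝ) ≤
          ∑ p ∈ T, ((containedFamily Y m s p.1 p.2).card : ℝ) := by
        exact_mod_cast (Finset.card_le_card hsub).trans Finset.card_biUnion_le
      refine h1.trans ((Finset.sum_le_card_nsmul _ _ _ fun p hp => ih ((hT1 p hp).1.trans hCY)
        (le_trans (by exact_mod_cast Finset.card_le_card (hT1 p hp).1) hC) ?_).trans ?_)
      · have := (hT1 p hp).2
        push_cast at hj
        linarith
      · rw [nsmul_eq_mul, pow_succ' _ j, mul_assoc]
        exact mul_le_mul_of_nonneg_right (by exact_mod_cast hT) (by positivity)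

lemma card_smallSumsetFamily_le {Y : Finset G} {m s k K J : ℕ} {ε M : ℝ} (hε : 0 < ε)
    (hs : 0 < s) (hm : 0 < m) (hk : 0 < k) (hmk : m ≤ k ^ 2) (hkm : 8 * (k : ℝ) ≤ ε * m)
    (hkK : 3 * k ≤ K) (hK : 16 * (k : ℝ) ≤ ε * K) (hM0 : 0 ≤ M)
    (hM : ∀ C D : Finset G, D.card ≤ m → (outPairs C D : ℝ) ≤ ε * (m : ℝ) ^ 2 →
      (C.card.choose s : ℝ) ≤ M) (hJ : 24 < J * ε) :
    ((smallSumsetFamily Y m s).card : ℝ) ≤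
      2 ^ J * ((Y.card : ℝ) + 1) ^ (K * (2 * J + 1)) * M := by
  set P := smallSubsets Y K with hP
  have hm' : (0 : ℝ) < m := by exact_mod_cast hm
  let f : Finset G → Finset G := fun F => {y ∈ Y | 2 * outDegree F (F + F) y < F.card}
  set T := {F ∈ P | F.Nonempty ∧ (F + F).card ≤ m} with hT
  have hsub : smallSumsetFamily Y m s ⊆ T.biUnion fun F => containedFamily Y m s (f F) ∅ := by
    intro A hA
    have hA' := hA
    rw [smallSumsetFamily, Finset.mem_filter, Finset.mem_powersetCard] at hA'
    obtain ⟨⟨hAY, hAs⟩, hAm⟩ := hA'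
    obtain ⟨F, hFA, hF, hsat⟩ := exists_subset_sums_saturated A
    have hFm : (F + F).card ≤ m := (Finset.card_le_card (Finset.add_subset_add hFA hFA)).trans hAm
    have hA0 : A.Nonempty := Finset.card_pos.1 (by omega)
    obtain ⟨a, ha⟩ := hA0
    have hF0 : F.Nonempty := Finset.card_pos.1 (lt_of_le_of_lt (Nat.zero_le _) (hsat a ha))
    have hFK : F.card ≤ K := by
      -- |F|² - |F| ≤ 4m ≤ 4k² is impossible once |F| > 3k.
      by_contra! hcon
      nlinarith
    refine Finset.mem_biUnion.2 ⟨F, ?_, ?_⟩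
    · rw [hT, hP, smallSubsets, Finset.mem_filter, Finset.mem_filter, Finset.mem_powerset]
      exact ⟨⟨hFA.trans hAY, hFK⟩, hF0, hFm⟩
    · rw [mem_containedFamily]
      refine ⟨⟨⟨hAY, hAs⟩, hAm⟩, fun a ha => Finset.mem_filter.2 ⟨hAY ha, hsat a ha⟩, ?_⟩
      exact Finset.empty_subset _
  have h1 : ((smallSumsetFamily Y m s).card : ℝ) ≤
      ∑ F ∈ T, ((containedFamily Y m s (f F) ∅).card : ℝ) := by
    exact_mod_cast (Finset.card_le_card hsub).trans Finset.card_biUnion_le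
  have h2 : ∀ F ∈ T, ((containedFamily Y m s (f F) ∅).card : ℝ) ≤
      ((2 * P.card ^ 2 : ℕ) : ℝ) ^ J * M := by
    intro F hF
    rw [hT, Finset.mem_filter] at hF
    have hc : ((f F).card : ℝ) ≤ 2 * m := by
      exact_mod_cast card_filter_outDegree_le Y hF.2.1 hF.2.2
    refine card_containedFamily_le hε hm hk hmk hkm (by omega) hK hM0 hM J
      (Finset.filter_subset _ _) hc ?_
    rw [Finset.card_empty, Nat.cast_zero]
    -- The initial potential is at most 2m + m = 3m, whence 24 < Jε.
    nlinarith
  refine h1.trans ((Finset.sum_le_card_nsmul _ _ _ h2).trans ?_)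
  rw [nsmul_eq_mul, ← mul_assoc]
  refine mul_le_mul_of_nonneg_right ?_ hM0
  have h3 : (P.card : ℝ) ≤ ((Y.card : ℝ) + 1) ^ K := by exact_mod_cast card_smallSubsets_le Y K
  have h4 : (T.card : ℝ) ≤ P.card := by exact_mod_cast Finset.card_filter_le _ _
  calc (T.card : ℝ) * ((2 * P.card ^ 2 : ℕ) : ℝ) ^ J
      ≤ P.card * ((2 * P.card ^ 2 : ℕ) : ℝ) ^ J := mul_le_mul_of_nonneg_right h4 (by positivity)
    _ = 2 ^ J * (P.card : ℝ) ^ (2 * J + 1) := by push_cast; ring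
    _ ≤ 2 ^ J * (((Y.card : ℝ) + 1) ^ K) ^ (2 * J + 1) := by gcongr
    _ = _ := by rw [pow_mul]

end Counting

/-! ### Binomial coefficients with real upper entry -/

section Binomial

lemma realBinom_mono {x y : ℝ} (h : x ≤ y) (s : ℕ) : realBinom x s ≤ realBinom y s := by
  have hnn : ∀ {z : ℝ}, (s : ℝ) ≤ z → ∀ i ∈ Finset.range s, 0 ≤ z - i := fun hz i hi => by
    have : (i : ℝ) ≤ s := by exact_mod_cast (Finset.mem_range.1 hi).le
    linarith
  unfold realBinom
  split_ifs with hx hy hy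
  · refine div_le_div_of_nonneg_right (Finset.prod_le_prod (hnn hx) fun i _ => ?_)
      (Nat.cast_nonneg _)
    linarith
  · exact absurd (hx.trans h) hy
  · exact div_nonneg (Finset.prod_nonneg (hnn hy)) (Nat.cast_nonneg _)
  · rfl

lemma choose_le_realBinom (c s : ℕ) : (c.choose s : ℝ) ≤ realBinom c s := by
  unfold realBinom
  split_ifs with h
  · have h' : s ≤ c := by exact_mod_cast h
    rw [le_div_iff₀ (by positivity), mul_comm, ← Nat.cast_mul, ← Nat.descFactorial_eq_factorial_mul_choose,
      Nat.descFactorial_eq_prod_range, Nat.cast_prod]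
    refine (Finset.prod_congr rfl fun i hi => ?_).le
    rw [Nat.cast_sub ((Finset.mem_range.1 hi).le.trans h')]
  · have h' : c < s := by
      rw [not_le] at h
      exact_mod_cast h
    rw [Nat.choose_eq_zero_of_lt h', Nat.cast_zero]

lemma one_le_realBinom {x : ℝ} {s : ℕ} (h : (s : ℝ) ≤ x) : 1 ≤ realBinom x s :=
  calc (1 : ℝ) = (s.choose s : ℝ) := by simp
    _ ≤ realBinom s s := choose_le_realBinom s s
    _ ≤ realBinom x s := realBinom_mono h s

lemma one_add_le_exp_two_sqrt {t : ℝ} (ht : 0 ≤ t) : 1 + t ≤ Real.exp (2 * √t) := by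
  have h := Real.quadratic_le_exp_of_nonneg (x := 2 * √t) (by positivity)
  have h2 := Real.sq_sqrt ht
  nlinarith [Real.sqrt_nonneg t]

lemma sum_inv_sqrt_le (s : ℕ) : ∑ j ∈ Finset.range s, 1 / √((j : ℝ) + 1) ≤ 2 * √s := by
  induction s with
  | zero => simp
  | succ s ih =>
    rw [Finset.sum_range_succ]
    push_cast
    have h0 : (0 : ℝ) ≤ s := Nat.cast_nonneg s
    have h1 : 0 < √((s : ℝ) + 1) := Real.sqrt_pos.2 (by linarith)
    have h2 := Real.sq_sqrt (show (0 : ℝ) ≤ s + 1 by linarith)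
    have h3 := Real.sq_sqrt h0
    have h4 : 1 / √((s : ℝ) + 1) ≤ 2 * √((s : ℝ) + 1) - 2 * √(s : ℝ) := by
      rw [div_le_iff₀ h1]
      nlinarith [sq_nonneg (√((s : ℝ) + 1) - √(s : ℝ))]
    linarith

/-- The i-th factor grows by at most 1 + τs/(s - i). Using 1 + t ≤ e^t would lose a log s when x is
near s; 1 + t ≤ e^{2√t} gives a sum of (s - i)^{-1/2}, which is O(√s). -/
lemma realBinom_add_le {x y τ : ℝ} {s : ℕ} (hτ : 0 ≤ τ) (hx : (s : ℝ) ≤ x) (hy : 0 ≤ y)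
    (hyx : y ≤ τ * x) :
    realBinom (x + y) s ≤ Real.exp (4 * √τ * s) * realBinom x s := by
  unfold realBinom
  rw [if_pos (by linarith), if_pos hx, ← mul_div_assoc]
  refine div_le_div_of_nonneg_right ?_ (Nat.cast_nonneg _)
  have h1 : ∀ i ∈ Finset.range s, x + y - i ≤
      Real.exp (2 * √τ * √s * (1 / √((s : ℝ) - i))) * (x - i) := by
    intro i hi
    have hi' : (i : ℝ) + 1 ≤ s := by exact_mod_cast Finset.mem_range.1 hi
    have hi0 : (0 : ℝ) ≤ i := Nat.cast_nonneg i
    have hsi : 0 < (s : ℝ) - i := by linarith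
    have hxi : 0 < x - i := by linarith
    have h2 : y / (x - i) ≤ τ * s / (s - i) := by
      rw [div_le_div_iff₀ hxi hsi]
      have h3 : y * (s - i) ≤ τ * x * (s - i) := mul_le_mul_of_nonneg_right hyx hsi.le
      have h4 : τ * (x * (s - i)) ≤ τ * (s * (x - i)) := by
        refine mul_le_mul_of_nonneg_left ?_ hτ
        nlinarith
      linarith
    have h3 : 1 + y / (x - i) ≤ Real.exp (2 * √(τ * s / (s - i))) :=
      (add_le_add_right h2 1).trans (one_add_le_exp_two_sqrt (by positivity))
    have h4 : 2 * √(τ * s / ((s : ℝ) - i)) = 2 * √τ * √s * (1 / √((s : ℝ) - i)) := by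
      rw [Real.sqrt_div (by positivity), Real.sqrt_mul hτ]
      ring
    rw [h4] at h3
    calc x + y - i = (1 + y / (x - i)) * (x - i) := by field_simp; ring
      _ ≤ _ := mul_le_mul_of_nonneg_right h3 hxi.le
  calc ∏ i ∈ Finset.range s, (x + y - i)
      ≤ ∏ i ∈ Finset.range s, Real.exp (2 * √τ * √s * (1 / √((s : ℝ) - i))) * (x - i) := by
        refine Finset.prod_le_prod (fun i hi => ?_) h1
        have : (i : ℝ) ≤ s := by exact_mod_cast (Finset.mem_range.1 hi).le
        linarith
    _ = Real.exp (2 * √τ * √s * ∑ i ∈ Finset.range s, 1 / √((s : ℝ) - i)) *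
          ∏ i ∈ Finset.range s, (x - i) := by
        rw [Finset.prod_mul_distrib, ← Real.exp_sum, Finset.mul_sum]
    _ ≤ _ := by
        refine mul_le_mul_of_nonneg_right (Real.exp_le_exp.2 ?_) (Finset.prod_nonneg fun i hi => ?_)
        · have h2 : ∑ i ∈ Finset.range s, 1 / √((s : ℝ) - i) =
              ∑ j ∈ Finset.range s, 1 / √((j : ℝ) + 1) := by
            rw [← Finset.sum_range_reflect]
            refine Finset.sum_congr rfl fun i hi => ?_
            have hi' : i + 1 ≤ s := Finset.mem_range.1 hi
            rw [Nat.sub_sub, add_comm 1 i, Nat.cast_sub hi']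
            push_cast
            ring_nf
          rw [h2]
          have h3 := mul_le_mul_of_nonneg_left (sum_inv_sqrt_le s)
            (show 0 ≤ 2 * √τ * √(s : ℝ) by positivity)
          have h4 := Real.mul_self_sqrt (Nat.cast_nonneg (α := ℝ) s)
          calc _ ≤ _ := h3
            _ = 4 * √τ * (√(s : ℝ) * √(s : ℝ)) := by ring
            _ = _ := by rw [h4]
        · have : (i : ℝ) ≤ s := by exact_mod_cast (Finset.mem_range.1 hi).le
          linarith

end Binomial

/-! ### Largest subgroup of bounded size -/

section Subgroup

lemma bddAbove_subgroup_cards (G : Type*) [AddCommGroup G] (x : ℝ) :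
    BddAbove {k : ℕ | ∃ H : AddSubgroup G, Finite H ∧ Nat.card H = k ∧ (k : ℝ) ≤ x} := by
  refine ⟨⌊x⌋₊, ?_⟩
  rintro k ⟨H, _, _, hk⟩
  exact Nat.le_floor hk

lemma card_le_subgroupBeta {G : Type*} [AddCommGroup G] {x : ℝ} (H : AddSubgroup G)
    (hH : Finite H) (h : (Nat.card H : ℝ) ≤ x) : Nat.card H ≤ subgroupBeta G x :=
  le_csSup (bddAbove_subgroup_cards G x) ⟨H, hH, rfl, h⟩

lemma subgroupBeta_mono (G : Type*) [AddCommGroup G] {x y : ℝ} (h : x ≤ y) :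
    subgroupBeta G x ≤ subgroupBeta G y := by
  unfold subgroupBeta
  rcases Set.eq_empty_or_nonempty
    {k : ℕ | ∃ H : AddSubgroup G, Finite H ∧ Nat.card H = k ∧ (k : ℝ) ≤ x} with h0 | h0
  · rw [h0]
    simp
  · refine csSup_le_csSup (bddAbove_subgroup_cards G y) h0 ?_
    rintro k ⟨H, hH, hk, hkx⟩
    exact ⟨H, hH, hk, hkx.trans h⟩

end Subgroup

/-! ### Choice of parameters and error terms -/

section Main

universe u

lemma exp_le_two_rpow {a : ℝ} (ha : 0 ≤ a) : Real.exp a ≤ (2 : ℝ) ^ (2 * a) := by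
  rw [Real.rpow_def_of_pos two_pos]
  refine Real.exp_le_exp.2 ?_
  have := Real.log_two_gt_d9
  nlinarith

lemma two_pow_mul_pow_le {n J N : ℕ} (hn : 2 ≤ n) (hJ : J ≤ N) :
    (2 : ℝ) ^ J * ((n : ℝ) + 1) ^ N ≤ (2 : ℝ) ^ (3 * (Real.logb 2 n * N)) := by
  have hn' : (2 : ℝ) ≤ n := by exact_mod_cast hn
  have h1 : (n : ℝ) + 1 ≤ n ^ 2 := by nlinarith
  have h2 : (2 : ℝ) ^ J ≤ (n : ℝ) ^ N :=
    (pow_le_pow_left₀ zero_le_two hn' J).trans (pow_le_pow_right₀ (by linarith) hJ)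
  have h3 : (2 : ℝ) ^ (Real.logb 2 n) = n :=
    Real.rpow_logb two_pos (by norm_num) (by linarith)
  calc (2 : ℝ) ^ J * ((n : ℝ) + 1) ^ N ≤ (n : ℝ) ^ N * (n ^ 2) ^ N := by gcongr
    _ = (n : ℝ) ^ (3 * N) := by ring
    _ = (2 : ℝ) ^ (3 * (Real.logb 2 n * N)) := by
      rw [show 3 * (Real.logb 2 n * (N : ℝ)) = Real.logb 2 n * ((3 * N : ℕ) : ℝ) by push_cast; ring,
        Real.rpow_mul zero_le_two, h3, Real.rpow_natCast]

/-- The bound of the main theorem for sets `Y` of size `n`, with error terms `ε s` and `ε m`. -/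
def SmallSumsetBound (m s n : ℕ) (ε : ℝ) : Prop :=
  ∀ (G : Type u) [AddCommGroup G] [DecidableEq G] (Y : Finset G), Y.card = n →
    ((smallSumsetFamily Y m s).card : ℝ) ≤
      (2 : ℝ) ^ (ε * s) *
        realBinom (((m : ℝ) + (subgroupBeta G ((m : ℝ) + ε * m) : ℝ)) / 2) s

lemma SmallSumsetBound.mono {m s n : ℕ} {ε ε' : ℝ} (hsm : 2 * s ≤ m)
    (h : SmallSumsetBound.{u} m s n ε) (hε : ε ≤ ε') : SmallSumsetBound.{u} m s n ε' := by
  intro G _ _ Y hY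
  refine (h G Y hY).trans ?_
  have hsm' : 2 * (s : ℝ) ≤ m := by exact_mod_cast hsm
  have h1 : realBinom (((m : ℝ) + (subgroupBeta G ((m : ℝ) + ε * m) : ℝ)) / 2) s ≤
      realBinom (((m : ℝ) + (subgroupBeta G ((m : ℝ) + ε' * m) : ℝ)) / 2) s := by
    refine realBinom_mono ?_ s
    have : (subgroupBeta G ((m : ℝ) + ε * m) : ℝ) ≤ subgroupBeta G ((m : ℝ) + ε' * m) := by
      exact_mod_cast subgroupBeta_mono G (by gcongr)
    linarith
  have h2 : 0 ≤ realBinom (((m : ℝ) + (subgroupBeta G ((m : ℝ) + ε * m) : ℝ)) / 2) s := by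
    refine zero_le_one.trans (one_le_realBinom ?_)
    have : (0 : ℝ) ≤ subgroupBeta G ((m : ℝ) + ε * m) := Nat.cast_nonneg _
    linarith
  refine mul_le_mul ?_ h1 h2 (by positivity)
  exact Real.rpow_le_rpow_of_exponent_le one_le_two (by gcongr)

/-- The trivial count 2^n; it ensures that some admissible ε exists for every n. -/
lemma smallSumsetBound_self {m s n : ℕ} (hs : 1 ≤ s) (hsm : 2 * s ≤ m) :
    SmallSumsetBound.{u} m s n n := by
  intro G _ _ Y hY
  have hsm' : 2 * (s : ℝ) ≤ m := by exact_mod_cast hsm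
  have hs' : (1 : ℝ) ≤ s := by exact_mod_cast hs
  have h1 : 1 ≤ realBinom (((m : ℝ) + (subgroupBeta G ((m : ℝ) + n * m) : ℝ)) / 2) s := by
    refine one_le_realBinom ?_
    have : (0 : ℝ) ≤ subgroupBeta G ((m : ℝ) + n * m) := Nat.cast_nonneg _
    linarith
  have h2 : (smallSumsetFamily Y m s).card ≤ 2 ^ n := by
    rw [← hY, ← Finset.card_powerset]
    refine Finset.card_le_card fun A hA => ?_
    rw [smallSumsetFamily, Finset.mem_filter, Finset.mem_powersetCard] at hA
    exact Finset.mem_powerset.2 hA.1.1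
  calc ((smallSumsetFamily Y m s).card : ℝ) ≤ (2 : ℝ) ^ (n : ℝ) := by
        rw [Real.rpow_natCast]; exact_mod_cast h2
    _ ≤ (2 : ℝ) ^ ((n : ℝ) * s) := Real.rpow_le_rpow_of_exponent_le one_le_two
        (le_mul_of_one_le_right (Nat.cast_nonneg _) hs')
    _ ≤ _ := le_mul_of_one_le_right (by positivity) h1

/-- The excess 3γm/2 is at most 3γ times (m + β)/2, so τ = 3γ works. -/
lemma choose_le_of_outPairs_le {G : Type*} [AddCommGroup G] [DecidableEq G] {m s : ℕ} {γ ε : ℝ}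
    (hγ : 0 < γ) (hγ' : γ ≤ 1 / 4) (hγε : 2 * γ ≤ ε) (hm : 1 ≤ γ * m) (hsm : 2 * s ≤ m)
    {C D : Finset G} (hD : D.card ≤ m) (h : (outPairs C D : ℝ) ≤ γ ^ 2 * (m : ℝ) ^ 2) :
    (C.card.choose s : ℝ) ≤ Real.exp (4 * √(3 * γ) * s) *
      realBinom (((m : ℝ) + (subgroupBeta G ((m : ℝ) + ε * m) : ℝ)) / 2) s := by
  have hsm' : 2 * (s : ℝ) ≤ m := by exact_mod_cast hsm
  have hm0 : (0 : ℝ) ≤ m := Nat.cast_nonneg m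
  have hb0 : (0 : ℝ) ≤ subgroupBeta G ((m : ℝ) + ε * m) := Nat.cast_nonneg _
  have h1 := card_le_of_outPairs_le (b := (subgroupBeta G ((m : ℝ) + ε * m) : ℝ)) hγ hγ' hm hb0
    (fun H hH hle => by
      have h2 : (m : ℝ) + 2 * γ * m ≤ m + ε * m := by gcongr
      exact_mod_cast card_le_subgroupBeta H hH (hle.trans h2))
    (by exact_mod_cast hD) h
  refine (choose_le_realBinom _ _).trans ((realBinom_mono h1 s).trans ?_)
  refine realBinom_add_le (by positivity) (by linarith) (by positivity) ?_
  nlinarith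

lemma exponent_le {ε e d k K L s J : ℝ} (he : 0 < e) (hs : 0 ≤ s)
    (hL : 0 ≤ L) (hJ : 0 ≤ J) (hK : e * K ≤ 17 * k) (hLk : L * k ≤ 2 * d * s)
    (hdε : d * (204 * (2 * J + 1)) ≤ ε * e) : 3 * (L * (K * (2 * J + 1))) ≤ ε / 2 * s := by
  have h1 : e * (L * K) ≤ 34 * d * s := by
    have := mul_le_mul_of_nonneg_left hK hL
    linarith
  refine le_of_mul_le_mul_left ?_ he
  calc e * (3 * (L * (K * (2 * J + 1)))) = e * (L * K) * (3 * (2 * J + 1)) := by ring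
    _ ≤ 34 * d * s * (3 * (2 * J + 1)) := by gcongr
    _ = d * (204 * (2 * J + 1)) * (s / 2) := by ring
    _ ≤ ε * e * (s / 2) := by gcongr
    _ = _ := by ring

lemma exists_smallSumsetBound {ε : ℝ} (hε : 0 < ε) (hε1 : ε ≤ 1) :
    ∃ δ > 0, ∀ m s n : ℕ, 2 ≤ n → 1 ≤ s → 2 * s ≤ m →
      (m : ℝ) ≤ δ * ((s : ℝ) ^ 2 / Real.logb 2 n ^ 2) → SmallSumsetBound.{u} m s n ε := by
  -- Makes 4√(3γ) = ε/4, so the binomial loss is at most 2^{εs/2}; the other half of the exponent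
  -- pays for the containers.
  obtain ⟨γ, hγ⟩ : ∃ γ, γ = ε ^ 2 / 768 := ⟨_, rfl⟩
  have hγ0 : 0 < γ := by rw [hγ]; positivity
  have hγ1 : γ ≤ 1 / 4 := by rw [hγ]; nlinarith
  have hγε : 2 * γ ≤ ε := by rw [hγ]; nlinarith
  have hsq : √(3 * γ) = ε / 16 := by
    rw [hγ, show 3 * (ε ^ 2 / 768) = (ε / 16) ^ 2 by ring, Real.sqrt_sq (by positivity)]
  obtain ⟨e, he⟩ : ∃ e, e = γ ^ 2 := ⟨_, rfl⟩
  have he0 : 0 < e := by rw [he]; positivity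
  have heγ : e ≤ γ := by rw [he]; nlinarith
  obtain ⟨J, hJ⟩ : ∃ J : ℕ, 24 / e < J := exists_nat_gt _
  have hJe : 24 < J * e := by rwa [div_lt_iff₀ he0] at hJ
  obtain ⟨d, hd⟩ : ∃ d, d = min (e / 8) (ε * e / (204 * (2 * J + 1))) := ⟨_, rfl⟩
  have hd0 : 0 < d := by
    rw [hd]
    exact lt_min (by positivity) (by positivity)
  have hd1 : d ≤ e / 8 := by rw [hd]; exact min_le_left _ _
  have hd2 : d * (204 * (2 * J + 1)) ≤ ε * e := by
    rw [← le_div_iff₀ (by positivity), hd]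
    exact min_le_right _ _
  refine ⟨d ^ 2, by positivity, fun m s n hn hs hsm hm G _ _ Y hY => ?_⟩
  have hs' : (1 : ℝ) ≤ s := by exact_mod_cast hs
  have hsm' : 2 * (s : ℝ) ≤ m := by exact_mod_cast hsm
  have hL : 1 ≤ Real.logb 2 n := by
    rw [Real.le_logb_iff_rpow_le one_lt_two (by positivity)]
    simpa using hn
  rw [mul_div_assoc', le_div_iff₀ (by positivity)] at hm
  generalize hLdef : Real.logb 2 n = L at *
  -- The hypothesis itself forces m to be large: m ≤ d²s² ≤ d²m²/4, and d ≤ e/8.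
  have hmlarge : 256 ≤ e ^ 2 * m := by
    have h1 : (m : ℝ) ≤ d ^ 2 * s ^ 2 :=
      (le_mul_of_one_le_right (Nat.cast_nonneg m) (one_le_pow₀ hL)).trans hm
    have h2 : (m : ℝ) * 4 ≤ m * (d ^ 2 * m) := by
      have : 4 * (s : ℝ) ^ 2 ≤ m ^ 2 := by nlinarith
      nlinarith [mul_le_mul_of_nonneg_left this (sq_nonneg d)]
    have h3 : 4 ≤ d ^ 2 * m := le_of_mul_le_mul_left h2 (by linarith)
    have h4 : d ^ 2 ≤ (e / 8) ^ 2 := pow_le_pow_left₀ hd0.le hd1 2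
    nlinarith
  have hm1 : 1 ≤ γ * m := by
    have : e ^ 2 ≤ γ := by nlinarith
    nlinarith
  obtain ⟨k, hk⟩ : ∃ k, k = Nat.sqrt m + 1 := ⟨_, rfl⟩
  have hmk : m ≤ k ^ 2 := by rw [hk]; exact (Nat.lt_succ_sqrt' m).le
  have hk4 : k ^ 2 ≤ 4 * m := by
    have h1 := Nat.sqrt_le' m
    have h2 : 1 ≤ Nat.sqrt m := Nat.sqrt_pos.2 (by omega)
    rw [hk]
    nlinarith
  have hk4' : (k : ℝ) ^ 2 ≤ 4 * m := by exact_mod_cast hk4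
  have hk1 : (1 : ℝ) ≤ k := by exact_mod_cast (by omega : 1 ≤ k)
  have hkm : 8 * (k : ℝ) ≤ e * m := by
    refine (sq_le_sq₀ (by positivity) (by positivity)).1 ?_
    have h1 : 256 * (m : ℝ) ≤ e ^ 2 * m * m :=
      mul_le_mul_of_nonneg_right hmlarge (Nat.cast_nonneg m)
    linarith
  have hLk : L * k ≤ 2 * d * s := by
    refine (sq_le_sq₀ (by positivity) (by positivity)).1 ?_
    have h1 := mul_le_mul_of_nonneg_left hk4' (sq_nonneg L)
    linarith
  obtain ⟨K, hKdef⟩ : ∃ K, K = ⌈16 * (k : ℝ) / e⌉₊ := ⟨_, rfl⟩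
  have hK1 : 16 * (k : ℝ) ≤ e * K := by
    rw [mul_comm e, ← div_le_iff₀ he0, hKdef]
    exact Nat.le_ceil _
  have hK2 : e * K ≤ 17 * k := by
    have h1 := (Nat.ceil_lt_add_one (show 0 ≤ 16 * (k : ℝ) / e by positivity)).le
    rw [← hKdef] at h1
    calc e * K ≤ e * (16 * (k : ℝ) / e + 1) := by gcongr
      _ = 16 * k + e := by field_simp
      _ ≤ 17 * k := by linarith
  have hkK : 3 * k ≤ K := by
    have h1 : e * (K : ℝ) ≤ 1 * K := mul_le_mul_of_nonneg_right (by linarith) (Nat.cast_nonneg K)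
    have : 3 * (k : ℝ) ≤ K := by linarith
    exact_mod_cast this
  have hJK : J ≤ K * (2 * J + 1) :=
    (by omega : J ≤ 2 * J + 1).trans (Nat.le_mul_of_pos_left _ (by omega))
  have hcount := card_smallSumsetFamily_le (Y := Y) (s := s) he0 (by omega) (by omega) (by omega)
    hmk hkm hkK hK1 (M := Real.exp (4 * √(3 * γ) * s) *
      realBinom (((m : ℝ) + (subgroupBeta G ((m : ℝ) + ε * m) : ℝ)) / 2) s) ?_ ?_ hJe
  · refine hcount.trans ?_
    rw [← mul_assoc]
    have hb0 : (0 : ℝ) ≤ subgroupBeta G ((m : ℝ) + ε * m) := Nat.cast_nonneg _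
    refine mul_le_mul_of_nonneg_right ?_ (zero_le_one.trans (one_le_realBinom (by linarith)))
    have h1 := two_pow_mul_pow_le (J := J) (N := K * (2 * J + 1)) hn hJK
    rw [hLdef] at h1
    have h2 : 3 * (L * ((K * (2 * J + 1) : ℕ) : ℝ)) ≤ ε / 2 * s := by
      push_cast
      exact exponent_le he0 (by positivity) (by linarith) (Nat.cast_nonneg J) hK2 hLk hd2
    have h3 : Real.exp (4 * √(3 * γ) * s) ≤ (2 : ℝ) ^ (ε / 2 * s) := by
      refine (exp_le_two_rpow (by positivity)).trans_eq ?_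
      rw [hsq]
      ring_nf
    rw [hY]
    calc (2 : ℝ) ^ J * ((n : ℝ) + 1) ^ (K * (2 * J + 1)) * Real.exp (4 * √(3 * γ) * s)
        ≤ (2 : ℝ) ^ (ε / 2 * s) * (2 : ℝ) ^ (ε / 2 * s) := by
          refine mul_le_mul (h1.trans ?_) h3 (Real.exp_nonneg _) (by positivity)
          exact Real.rpow_le_rpow_of_exponent_le one_le_two h2
      _ = (2 : ℝ) ^ (ε * s) := by
          rw [← Real.rpow_add two_pos]
          ring_nf
  · have hb0 : (0 : ℝ) ≤ subgroupBeta G ((m : ℝ) + ε * m) := Nat.cast_nonneg _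
    exact mul_nonneg (Real.exp_nonneg _) (zero_le_one.trans (one_le_realBinom (by linarith)))
  · intro C D hD hout
    rw [he] at hout
    exact choose_le_of_outPairs_le hγ0 hγ1 hγε hm1 hsm hD hout

end Main

theorem theorem1p2 (m s : ℕ → ℕ)
    (hs : ∀ n : ℕ, 1 ≤ n → 1 ≤ s n)
    (hsm : ∀ n : ℕ, 1 ≤ n → 2 * s n ≤ m n)
    (hm : (fun n : ℕ => (m n : ℝ)) =o[atTop]
      (fun n : ℕ => (s n : ℝ) ^ 2 / (Real.logb 2 n) ^ 2)) :
    ∃ e₁ e₂ : ℕ → ℝ,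
      e₁ =o[atTop] (fun n : ℕ => (s n : ℝ)) ∧
      e₂ =o[atTop] (fun n : ℕ => (m n : ℝ)) ∧
      (∀ n : ℕ, 0 ≤ e₂ n) ∧
      ∀ n : ℕ, 1 ≤ n → ∀ (G : Type*) [AddCommGroup G] [DecidableEq G] (Y : Finset G),
        Y.card = n →
        ((smallSumsetFamily Y (m n) (s n)).card : ℝ) ≤
          (2 : ℝ) ^ (e₁ n) *
            realBinom (((m n : ℝ) + (subgroupBeta G ((m n : ℝ) + e₂ n) : ℝ)) / 2) (s n) := by
  -- Diagonalisation: the best ε for each n, uniform over all G and Y, so that the errors depend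
  -- only on m and s.
  let S : ℕ → Set ℝ := fun n => {ε | 0 ≤ ε ∧ SmallSumsetBound (m n) (s n) n ε}
  have hS0 : ∀ n, 0 ≤ sInf (S n) := fun n => Real.sInf_nonneg fun x hx => hx.1
  have hSb : ∀ n, BddBelow (S n) := fun n => ⟨0, fun x hx => hx.1⟩
  -- The infimum need not be attained; the vanishing positive term leaves room for an admissible ε
  -- below `e n`.
  let e : ℕ → ℝ := fun n => sInf (S n) + 1 / ((n : ℝ) + 1)
  have he0 : ∀ n, 0 ≤ e n := fun n => add_nonneg (hS0 n) (by positivity)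
  have hlim : Tendsto (fun n => sInf (S n)) atTop (nhds 0) := by
    rw [Metric.tendsto_atTop']
    intro η hη
    obtain ⟨δ, hδ, h⟩ := exists_smallSumsetBound (ε := min (η / 2) 1)
      (lt_min (by linarith) one_pos) (min_le_right _ _)
    obtain ⟨N, hN⟩ := eventually_atTop.1 (hm.bound hδ)
    refine ⟨max N 1, fun n hn => ?_⟩
    have hn1 : 1 < n := lt_of_le_of_lt (le_max_right _ _) hn
    have h1 := hN n ((le_max_left _ _).trans hn.le)
    rw [Real.norm_of_nonneg (Nat.cast_nonneg _), Real.norm_of_nonneg (by positivity)] at h1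
    have h2 : sInf (S n) ≤ min (η / 2) 1 := csInf_le (hSb n)
      ⟨le_min (by linarith) zero_le_one, h _ _ n hn1 (hs n hn1.le) (hsm n hn1.le) h1⟩
    rw [Real.dist_eq, sub_zero, abs_of_nonneg (hS0 n)]
    have := h2.trans (min_le_left _ _)
    linarith
  have helim : Tendsto e atTop (nhds 0) := by
    simpa only [add_zero] using hlim.add tendsto_one_div_add_atTop_nhds_zero_nat
  have heo : e =o[atTop] (fun _ => (1 : ℝ)) := (isLittleO_one_iff ℝ).2 helim
  refine ⟨fun n => e n * s n, fun n => e n * m n, ?_, ?_,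
    fun n => mul_nonneg (he0 n) (Nat.cast_nonneg _), fun n hn => ?_⟩
  · simpa using heo.mul_isBigO (isBigO_refl (fun n : ℕ => (s n : ℝ)) atTop)
  · simpa using heo.mul_isBigO (isBigO_refl (fun n : ℕ => (m n : ℝ)) atTop)
  · have hne : (S n).Nonempty :=
      ⟨n, Nat.cast_nonneg n, smallSumsetBound_self (hs n hn) (hsm n hn)⟩
    obtain ⟨ε, hε, hlt⟩ := exists_lt_of_csInf_lt hne
      (show sInf (S n) < e n from lt_add_of_pos_right _ (by positivity))
    exact hε.2.mono (hsm n hn) hlt.le
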